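/- Let $K$ be a field of characteristic different from $2$, let $\alpha \in K$ be non-zero, let $E$ be a finite-dimensional vector space over $K$, and let $u$ be an endomorphism of $E$. Call $u$ an $(\alpha,\alpha)$-composite if there are two idempotents $p, q \in \mathrm{End}(E)$ (that is, $p^2=p$ and $q^2=q$) such that $u = \alpha p + \alpha q$. For $\lambda \in K$ and an integer $k \ge 1$, set $$n_k(u,\lambda) := \dim \ker (u-\lambda\,\mathrm{id}_E)^k - \dim \ker (u-\lambda\,\mathrm{id}_E)^{k-1}.$$ Two sequences of integers $(a_k)_{k\ge 1}$ and $(b_k)_{k \ge 1}$ are called intertwined if $b_{k+1} \le a_k$ and $a_{k+1} \le b_k$ for all $k \ge 1$. Write the minimal polynomial of $u$ as $\mu_u = P\,Q$, where $P$ is monic and splits over $K$ with all its roots in $\{0,\alpha,2\alpha\}$, and $Q$ is monic with no root in $\{0,\alpha,2\alpha\}$; let $u_{-\{0,\alpha,2\alpha\}}$ denote the endomorphism of $\ker Q(u)$ induced by $u$. The elementary factors (invariant factors) of an endomorphism $v$ of a finite-dimensional $K$-vector space $F$ are the non-constant monic polynomials $P_1 \mid P_2 \mid \dots \mid P_N$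 in $K[X]$ such that $F$, regarded as a $K[X]$-module on which $X$ acts as $v$, is isomorphic to $\bigoplus_{i=1}^N K[X]/(P_i)$. Then $u$ is an $(\alpha,\alpha)$-composite if and only if both of the following conditions hold: (i) the sequences $(n_k(u,0))_{k\ge 1}$ and $(n_k(u,2\alpha))_{k\ge 1}$ are intertwined; (ii) every elementary factor of $u_{-\{0,\alpha,2\alpha\}}$ is a polynomial in $(X-\alpha)^2$, i.e. of the form $R\bigl((X-\alpha)^2\bigr)$ with $R \in K[X]$. -/

import Mathlib

open Polynomial

/-- An element `x` of a `K`-algebra is an `(α, β)`-composite when `x = α p + β q` for two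
idempotents `p` and `q` of that algebra. -/
def IsComposite {K A : Type*} [Field K] [Ring A] [Algebra K A] (α β : K) (x : A) : Prop :=
  ∃ p q : A, IsIdempotentElem p ∧ IsIdempotentElem q ∧ x = α • p + β • q

section Endomorphisms

variable {K E : Type*} [Field K] [AddCommGroup E] [Module K E]

/-- `jordanCount u lam k = dim Ker (u - lam)^k - dim Ker (u - lam)^(k-1)` for `k ≥ 1`: the number of
Jordan blocks of `u` of size at least `k` for the eigenvalue `lam`. Only used for `k ≥ 1`. -/
noncomputable def jordanCount (u : Module.End K E) (lam : K) (k : ℕ) : ℤ :=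
  (Module.finrank K (LinearMap.ker ((u - algebraMap K (Module.End K E) lam) ^ k)) : ℤ) -
    (Module.finrank K (LinearMap.ker ((u - algebraMap K (Module.End K E) lam) ^ (k - 1))) : ℤ)

/-- Two sequences indexed by the positive integers are intertwined when
`v_{k+1} ≤ u_k` and `u_{k+1} ≤ v_k` for all `k ≥ 1`. -/
def Intertwined (u v : ℕ → ℤ) : Prop :=
  ∀ k : ℕ, 1 ≤ k → v (k + 1) ≤ u k ∧ u (k + 1) ≤ v k

open Classical in
/-- The monic divisor of `p` that collects all roots of `p` lying in `S`, with multiplicity. -/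
noncomputable def rootsPart (S : Set K) (p : K[X]) : K[X] :=
  ((p.roots.filter (fun a => a ∈ S)).map (fun a => X - C a)).prod

/-- The cofactor `Q` in `p = P * Q`, where `P` is monic with all its roots in `S` and split, and
`Q` has no root in `S` (for `p ≠ 0`). -/
noncomputable def rootFreePart (S : Set K) (p : K[X]) : K[X] :=
  p /ₘ rootsPart S p

/-- The kernel of a polynomial in `u` is stable under `u`. -/
theorem mem_ker_aeval_of_mem (u : Module.End K E) (p : K[X]) :
    ∀ x ∈ LinearMap.ker (aeval u p), u x ∈ LinearMap.ker (aeval u p) := by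
  intro x hx
  have h : aeval u p * u = u * aeval u p := by
    simpa using congrArg (aeval u) (mul_comm p X)
  rw [LinearMap.mem_ker] at hx ⊢
  have h2 := LinearMap.congr_fun h x
  simp only [Module.End.mul_apply, hx, map_zero] at h2
  exact h2

/-- With `μ_u = P * Q` the minimal polynomial of `u`, where `P` is monic and split with all its
roots in `S` and `Q` is monic with no root in `S`, this is the subspace `Ker Q(u)`. -/
noncomputable def awaySubspace (S : Set K) (u : Module.End K E) : Submodule K E :=
  LinearMap.ker (aeval u (rootFreePart S (minpoly K u)))

/-- The endomorphism `u_{-S}` of `Ker Q(u)` induced by `u`. -/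
noncomputable def awayPart (S : Set K) (u : Module.End K E) :
    Module.End K (awaySubspace S u) :=
  u.restrict (mem_ker_aeval_of_mem u (rootFreePart S (minpoly K u)))

/-- `P_0 ∣ P_1 ∣ ⋯ ∣ P_{N-1}` is the list of elementary factors (invariant factors) of `u`: the
`P_i` are monic and nonconstant, each divides the next ones, and the `K[X]`-module `E` on which
`X` acts as `u` is isomorphic to the direct sum of the `K[X] / (P_i)`, i.e. `u` is represented
by the block-diagonal matrix of the companion matrices of the `P_i`. -/
def IsElementaryFactors (u : Module.End K E) {N : ℕ} (P : Fin N → K[X]) : Prop :=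
  (∀ i, (P i).Monic ∧ 0 < (P i).natDegree) ∧
  (∀ i j, i ≤ j → P i ∣ P j) ∧
  Nonempty (Module.AEval' u ≃ₗ[K[X]] ((i : Fin N) → K[X] ⧸ Ideal.span {P i}))

end Endomorphisms

/-! If `u = α p + α q`, then `D = α (p - q)` satisfies `D u = (2α - u) D` and `D² = u (2α - u)`.
Conversely, from such a `D` one recovers idempotents `(u ± D) / (2α)`. So `u` is a composite exactly
when the `K[X]`-module `E` carries a map, semilinear for `X ↦ 2α - X`, whose square is `X (2α - X)`:
this is `HasReflection`.

Sufficiency: such maps pass to direct sums, so they can be built on cyclic pieces as `f ↦ g · f(2α -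
X)` with `g = X` or `g = 2α - X`. A block at `α`, or a quotient by a polynomial in `(X - α)²`, is
its own mirror image. Blocks at `0` and `2α` are exchanged, which works if their sizes differ by at
most one; intertwining says that the blocks sorted by size pair up in this way.

Necessity of (i): `D` exchanges the kernels of the powers of `u` and of `u - 2α`, and on these `D²`
lowers the nilpotency level by exactly one. Dimension counts for `D` and `D³` give the inequalities
(`finrank_ker_pow_le_of_anticommute`).

Necessity of (ii): on `Ker Q(u)` the maps `u`, `u - α` and `u - 2α` are invertible, and `σ = u⁻¹ D`
is an involution anticommuting with `z = u - α`. Hence `z` exchanges the two eigenspaces of `σ`, and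
everything is determined by `z²` on the fixed space (`exists_even_elementaryFactors`). -/

/-! ### Invariant factors of torsion modules over a principal ideal domain -/

section PrincipalIdealDomain

variable {R : Type*} [CommRing R]

/-- The semilinear map `R ⧸ (a) → R ⧸ (b)` sending the class of `f` to the class of `c * σ f`. -/
def quotMul (σ : R →+* R) {a b : R} (c : R) (h : b ∣ c * σ a) :
    (R ⧸ Ideal.span {a}) →ₛₗ[σ] (R ⧸ Ideal.span {b}) :=
  Submodule.mapQ (Ideal.span {a}) (Ideal.span {b})
    { toFun := fun f => c * σ f
      map_add' := fun f g => by rw [map_add, mul_add]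
      map_smul' := fun f g => by simp only [smul_eq_mul, map_mul]; ring }
    (by
      intro f hf
      obtain ⟨r, rfl⟩ := Ideal.mem_span_singleton'.1 hf
      obtain ⟨s, hs⟩ := h
      exact Ideal.mem_span_singleton'.2 ⟨s * σ r, by
        simp only [LinearMap.coe_mk, AddHom.coe_mk, map_mul]
        linear_combination (-σ r) * hs⟩)

theorem quotMul_mk (σ : R →+* R) {a b : R} (c : R) (h : b ∣ c * σ a) (f : R) :
    quotMul σ c h (Ideal.Quotient.mk _ f) = Ideal.Quotient.mk (Ideal.span {b}) (c * σ f) := rfl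

/-- With `a = g a'`, `b = g b'` and `x a' + y b' = 1`, the product `R ⧸ (a) × R ⧸ (b)` is isomorphic
to the product of the quotients by the lcm and by the gcd. -/
theorem nonempty_quot_prod_equiv {g a' b' x y : R} (h : x * a' + y * b' = 1) :
    Nonempty (((R ⧸ Ideal.span {g * a'}) × (R ⧸ Ideal.span {g * b'})) ≃ₗ[R]
      ((R ⧸ Ideal.span {g * a' * b'}) × (R ⧸ Ideal.span {g}))) := by
  -- The matrix `(b', a'; x, -y)` has determinant `-1` by the Bézout relation; `(y, a'; x, -b')` is
  -- its inverse.
  let i := RingHom.id R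
  let m11 := quotMul i (a := g * a') (b := g * a' * b') b' ⟨1, by simp [i]; ring⟩
  let m12 := quotMul i (a := g * b') (b := g * a' * b') a' ⟨1, by simp [i]; ring⟩
  let m21 := quotMul i (a := g * a') (b := g) x ⟨x * a', by simp [i]; ring⟩
  let m22 := quotMul i (a := g * b') (b := g) (-y) ⟨-y * b', by simp [i]; ring⟩
  let n11 := quotMul i (b := g * a') (a := g * a' * b') y ⟨y * b', by simp [i]; ring⟩
  let n12 := quotMul i (b := g * a') (a := g) a' ⟨1, by simp [i]; ring⟩
  let n21 := quotMul i (b := g * b') (a := g * a' * b') x ⟨x * a', by simp [i]; ring⟩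
  let n22 := quotMul i (b := g * b') (a := g) (-b') ⟨-1, by simp [i]; ring⟩
  refine ⟨LinearEquiv.ofLinearMap ((m11.coprod m12).prod (m21.coprod m22))
    ((n11.coprod n12).prod (n21.coprod n22)) ?_ ?_⟩
  · refine LinearMap.ext ?_
    rintro ⟨s, t⟩
    obtain ⟨s, rfl⟩ := Ideal.Quotient.mk_surjective s
    obtain ⟨t, rfl⟩ := Ideal.Quotient.mk_surjective t
    simp only [LinearMap.comp_apply, LinearMap.prod_apply, Function.prod_apply,
      LinearMap.coprod_apply, m11, m12, m21, m22, n11, n12, n21, n22, quotMul_mk, i,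
      RingHom.id_apply, LinearMap.id_apply,
      ← map_add, Prod.mk.injEq]
    constructor
    · congr 1; linear_combination s * h
    · congr 1; linear_combination t * h
  · refine LinearMap.ext ?_
    rintro ⟨s, t⟩
    obtain ⟨s, rfl⟩ := Ideal.Quotient.mk_surjective s
    obtain ⟨t, rfl⟩ := Ideal.Quotient.mk_surjective t
    simp only [LinearMap.comp_apply, LinearMap.prod_apply, Function.prod_apply,
      LinearMap.coprod_apply, m11, m12, m21, m22, n11, n12, n21, n22, quotMul_mk, i,
      RingHom.id_apply, LinearMap.id_apply,
      ← map_add, Prod.mk.injEq]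
    constructor
    · congr 1; linear_combination s * h
    · congr 1; linear_combination t * h

variable [IsDomain R] [IsPrincipalIdealRing R]

theorem exists_gcd_cofactors (a b : R) :
    ∃ g a' b' x y : R, a = g * a' ∧ b = g * b' ∧ x * a' + y * b' = 1 := by
  obtain ⟨a', ha⟩ := IsBezout.gcd_dvd_left a b
  obtain ⟨b', hb⟩ := IsBezout.gcd_dvd_right a b
  obtain ⟨x, y, h⟩ := IsBezout.gcd_eq_sum a b
  by_cases hg : IsBezout.gcd a b = 0
  · refine ⟨0, 1, 0, 1, 0, ?_, ?_, by ring⟩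
    · rw [ha, hg]; ring
    · rw [hb, hg]; ring
  · refine ⟨_, a', b', x, y, ha, hb, mul_left_cancel₀ hg ?_⟩
    linear_combination h - x * ha - y * hb

/-- A cyclic summand can be merged into a product of cyclic modules whose annihilators form a
divisibility chain. -/
theorem exists_divisibility_chain_cons {n : ℕ} (P : Fin n → R) (hP : ∀ i j, i ≤ j → P j ∣ P i)
    (a : R) :
    ∃ P' : Fin (n + 1) → R, (∀ i j, i ≤ j → P' j ∣ P' i) ∧
      (∀ c, a ∣ c → (∀ i, P i ∣ c) → ∀ i, P' i ∣ c) ∧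
      Nonempty (((R ⧸ Ideal.span {a}) × ((i : Fin n) → R ⧸ Ideal.span {P i})) ≃ₗ[R]
        ((i : Fin (n + 1)) → R ⧸ Ideal.span {P' i})) := by
  induction n generalizing a with
  | zero =>
    refine ⟨Fin.cons a P, ?_, ?_, ⟨Fin.consLinearEquiv R
      (fun i => R ⧸ Ideal.span {(Fin.cons a P : Fin 1 → R) i})⟩⟩
    · intro i j _
      rw [Subsingleton.elim (α := Fin 1) i j]
    · intro c hc _ i
      rw [Subsingleton.elim (α := Fin 1) i 0]
      exact hc
  | succ n ih =>
    -- Trade `a` and `P 0` for their lcm and gcd: the lcm heads the new chain and the gcd is merged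
    -- into the tail. The clause on common multiples `c` ensures that the lcm dominates the merged
    -- tail.
    obtain ⟨g, a', b', x, y, ha, hb, h⟩ := exists_gcd_cofactors a (P 0)
    obtain ⟨e⟩ := nonempty_quot_prod_equiv (g := g) h
    obtain ⟨P'', hchain, hdvd, ⟨f⟩⟩ := ih (fun i => P i.succ)
      (fun i j hij => hP _ _ (Fin.succ_le_succ_iff.2 hij)) g
    have hl : ∀ i, P'' i ∣ g * a' * b' := hdvd _ ⟨a' * b', by ring⟩ fun i =>
      (hP 0 i.succ (Fin.zero_le _)).trans (hb ▸ ⟨a', by ring⟩)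
    refine ⟨Fin.cons (g * a' * b') P'', ?_, ?_, ?_⟩
    · intro i j hij
      refine Fin.cases (fun hij => ?_) (fun i hij => ?_) i hij
      · refine Fin.cases ?_ (fun j => ?_) j
        · exact dvd_rfl
        · simpa using hl j
      · refine Fin.cases (fun hij => ?_) (fun j hij => ?_) j hij
        · exact absurd hij (by simp)
        · simpa using hchain i j (Fin.succ_le_succ_iff.1 hij)
    · intro c hac hPc i
      have hl' : g * a' * b' ∣ c := by
        have h1 : g * a' ∣ c := ha ▸ hac
        have h2 : g * b' ∣ c := hb ▸ hPc 0
        obtain ⟨r, hr⟩ := h1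
        obtain ⟨s, hs⟩ := h2
        exact ⟨x * s + y * r, by linear_combination (-c) * h + x * a' * hs + y * b' * hr⟩
      refine Fin.cases ?_ (fun j => ?_) i
      · exact hl'
      · simpa using (hl j).trans hl'
    · subst ha
      let e0 : ((i : Fin (n + 1)) → R ⧸ Ideal.span {P i}) ≃ₗ[R]
          (R ⧸ Ideal.span {g * b'}) × ((i : Fin n) → R ⧸ Ideal.span {P i.succ}) :=
        (Fin.consLinearEquiv R (fun i => R ⧸ Ideal.span {P i})).symm ≪≫ₗ
          LinearEquiv.prodCongr (Submodule.quotEquivOfEq _ _ (by rw [hb])) (LinearEquiv.refl R _)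
      exact ⟨LinearEquiv.prodCongr (LinearEquiv.refl R _) e0 ≪≫ₗ
        (LinearEquiv.prodAssoc R _ _ _).symm ≪≫ₗ
        LinearEquiv.prodCongr e (LinearEquiv.refl R _) ≪≫ₗ
        LinearEquiv.prodAssoc R _ _ _ ≪≫ₗ
        LinearEquiv.prodCongr (LinearEquiv.refl R _) f ≪≫ₗ
        Fin.consLinearEquiv R (fun i => R ⧸ Ideal.span
          {(Fin.cons (g * a' * b') P'' : Fin (n + 2) → R) i})⟩

theorem exists_divisibility_chain_of_pi {n : ℕ} (a : Fin n → R) :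
    ∃ P : Fin n → R, (∀ i j, i ≤ j → P j ∣ P i) ∧
      Nonempty (((i : Fin n) → R ⧸ Ideal.span {a i}) ≃ₗ[R]
        ((i : Fin n) → R ⧸ Ideal.span {P i})) := by
  induction n with
  | zero => exact ⟨a, fun i => i.elim0, ⟨LinearEquiv.refl R _⟩⟩
  | succ n ih =>
    obtain ⟨P, hP, ⟨e⟩⟩ := ih (fun i => a i.succ)
    obtain ⟨P', hP', -, ⟨f⟩⟩ := exists_divisibility_chain_cons P hP (a 0)
    exact ⟨P', hP', ⟨(Fin.consLinearEquiv R (fun i => R ⧸ Ideal.span {a i})).symm ≪≫ₗ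
      LinearEquiv.prodCongr (LinearEquiv.refl R _) e ≪≫ₗ f⟩⟩

/-- Invariant factor decomposition of a finitely generated torsion module over a principal ideal
domain, with the largest factor first, padded by units to any large enough length. -/
theorem exists_divisibility_chain_of_isTorsion {M : Type*} [AddCommGroup M] [Module R M]
    [Module.Finite R M] (hM : Module.IsTorsion R M) :
    ∃ n₀ : ℕ, ∀ n, n₀ ≤ n → ∃ P : Fin n → R, (∀ i j, i ≤ j → P j ∣ P i) ∧
      Nonempty (M ≃ₗ[R] ((i : Fin n) → R ⧸ Ideal.span {P i})) := by
  classical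
  obtain ⟨ι, _, p, -, e, ⟨f⟩⟩ := Module.equiv_directSum_of_isTorsion hM
  let s := Fintype.equivFin ι
  refine ⟨Fintype.card ι, fun n hn => ?_⟩
  induction n, hn using Nat.le_induction with
  | base =>
    obtain ⟨P, hP, ⟨g⟩⟩ := exists_divisibility_chain_of_pi (fun i => p (s.symm i) ^ e (s.symm i))
    exact ⟨P, hP, ⟨f ≪≫ₗ DirectSum.linearEquivFunOnFintype R ι _ ≪≫ₗ
      (LinearEquiv.piCongrLeft R (fun i => R ⧸ Ideal.span {p i ^ e i}) s.symm).symm ≪≫ₗ g⟩⟩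
  | succ n hn ih =>
    obtain ⟨P, hP, ⟨g⟩⟩ := ih
    obtain ⟨P', hP', -, ⟨h⟩⟩ := exists_divisibility_chain_cons P hP 1
    have : Subsingleton (R ⧸ Ideal.span {(1 : R)}) :=
      Ideal.Quotient.subsingleton_iff.2 Ideal.span_singleton_one
    let := uniqueOfSubsingleton (0 : R ⧸ Ideal.span {(1 : R)})
    exact ⟨P', hP', ⟨g ≪≫ₗ (LinearEquiv.uniqueProd (R := R)
      (M₂ := R ⧸ Ideal.span {(1 : R)})).symm ≪≫ₗ h⟩⟩

/-- Invariant factor decomposition of a finitely generated torsion module over a principal ideal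
domain, with the smallest factor first. -/
theorem exists_invariant_factors {M : Type*} [AddCommGroup M] [Module R M]
    [Module.Finite R M] (hM : Module.IsTorsion R M) :
    ∃ (n : ℕ) (P : Fin n → R), (∀ i, ¬ IsUnit (P i)) ∧ (∀ i j, i ≤ j → P i ∣ P j) ∧
      Nonempty (M ≃ₗ[R] ((i : Fin n) → R ⧸ Ideal.span {P i})) := by
  classical
  obtain ⟨n₀, hn₀⟩ := exists_divisibility_chain_of_isTorsion hM
  have hex : ∃ n, ∃ P : Fin n → R, (∀ i j, i ≤ j → P j ∣ P i) ∧
      Nonempty (M ≃ₗ[R] ((i : Fin n) → R ⧸ Ideal.span {P i})) := ⟨n₀, hn₀ _ le_rfl⟩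
  -- In a chain of minimal length no factor is a unit: otherwise the last one, which divides all
  -- others, would be a unit and could be dropped.
  obtain ⟨P, hP, ⟨e⟩⟩ := Nat.find_spec hex
  have hmin := fun m => Nat.find_min hex (m := m)
  generalize Nat.find hex = n at P hP e hmin
  refine ⟨n, fun i => P i.rev, fun i hi => ?_, fun i j hij => hP _ _ (Fin.rev_le_rev.2 hij),
    ⟨e ≪≫ₗ (LinearEquiv.piCongrLeft R (fun i => R ⧸ Ideal.span {P i}) Fin.revPerm).symm⟩⟩
  obtain _ | n := n
  · exact i.elim0
  have hu : IsUnit (P (Fin.last n)) := isUnit_of_dvd_unit (hP _ _ (Fin.le_last _)) hi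
  refine hmin n (Nat.lt_succ_self n) ⟨fun i => P i.castSucc,
    fun i j hij => hP _ _ (Fin.castSucc_le_castSucc_iff.2 hij), ⟨e ≪≫ₗ ?_⟩⟩
  have : Subsingleton (R ⧸ Ideal.span {P (Fin.last n)}) :=
    Ideal.Quotient.subsingleton_iff.2 (Ideal.span_singleton_eq_top.2 hu)
  refine LinearEquiv.ofBijective (LinearMap.pi fun i => LinearMap.proj i.castSucc) ⟨?_, ?_⟩
  · intro x y hxy
    funext i
    refine Fin.lastCases (Subsingleton.elim _ _) (fun i => congrFun hxy i) i
  · intro y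
    refine ⟨Fin.lastCases 0 y, ?_⟩
    funext i
    simp

end PrincipalIdealDomain

/-! ### Semilinear square roots of `X (2α - X)` -/

section Reflection

variable {K : Type*} [Field K]

/-- The substitution `X ↦ 2α - X`. -/
noncomputable def substReflect (α : K) : K[X] →+* K[X] := compRingHom (C (2 * α) - X)

theorem substReflect_X (α : K) : substReflect α X = C (2 * α) - X := by simp [substReflect]

theorem substReflect_C (α a : K) : substReflect α (C a) = C a := by simp [substReflect]

theorem substReflect_substReflect (α : K) (f : K[X]) : substReflect α (substReflect α f) = f := by
  simp only [substReflect, coe_compRingHom_apply, comp_assoc, sub_comp, C_comp, X_comp]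
  rw [sub_sub_cancel, comp_X]

/-- A `K[X]`-module admits a square root of `X (2α - X)` that is semilinear with respect to the
substitution `X ↦ 2α - X`. -/
def HasReflection (α : K) (M : Type*) [AddCommGroup M] [Module K[X] M] : Prop :=
  ∃ D : M →ₛₗ[substReflect α] M, ∀ m, D (D m) = (X * (C (2 * α) - X) : K[X]) • m

namespace HasReflection

variable {α : K} {M N : Type*} [AddCommGroup M] [Module K[X] M] [AddCommGroup N] [Module K[X] N]

theorem congr (h : HasReflection α M) (e : M ≃ₗ[K[X]] N) : HasReflection α N := by
  obtain ⟨D, hD⟩ := h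
  refine ⟨e.toLinearMap.comp (D.comp e.symm.toLinearMap), fun m => ?_⟩
  simp [hD]

theorem pi {ι : Type*} {M : ι → Type*} [∀ i, AddCommGroup (M i)] [∀ i, Module K[X] (M i)]
    (h : ∀ i, HasReflection α (M i)) : HasReflection α (∀ i, M i) := by
  choose D hD using h
  refine ⟨⟨⟨fun m i => D i (m i), fun x y => ?_⟩, fun c x => ?_⟩, fun m => ?_⟩
  · funext i; simp
  · funext i; simp
  · funext i; simpa using hD i (m i)

theorem prod (hM : HasReflection α M) (hN : HasReflection α N) : HasReflection α (M × N) := by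
  obtain ⟨D, hD⟩ := hM
  obtain ⟨D', hD'⟩ := hN
  refine ⟨⟨⟨fun m => (D m.1, D' m.2), fun x y => ?_⟩, fun c x => ?_⟩, fun m => ?_⟩
  · simp
  · simp
  · exact Prod.ext (hD m.1) (hD' m.2)

theorem pi_prod {ι : Type*} {M N : ι → Type*} [∀ i, AddCommGroup (M i)] [∀ i, Module K[X] (M i)]
    [∀ i, AddCommGroup (N i)] [∀ i, Module K[X] (N i)]
    (h : ∀ i, HasReflection α (M i × N i)) : HasReflection α ((∀ i, M i) × (∀ i, N i)) :=
  (pi h).congr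
    { toFun := fun x => (fun i => (x i).1, fun i => (x i).2)
      invFun := fun x i => (x.1 i, x.2 i)
      map_add' := fun _ _ => rfl
      map_smul' := fun _ _ => rfl }

/-- The map is `f ↦ g · f(2α - X)`. As the substitution is an involution, its square is
multiplication by `g · g(2α - X)`. -/
theorem quotient {P g : K[X]} (hg : g * substReflect α g = X * (C (2 * α) - X))
    (hP : P ∣ g * substReflect α P) : HasReflection α (K[X] ⧸ Ideal.span {P}) := by
  refine ⟨quotMul (substReflect α) g hP, fun m => ?_⟩
  obtain ⟨f, rfl⟩ := Ideal.Quotient.mk_surjective m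
  rw [quotMul_mk, quotMul_mk, ← hg, map_mul (substReflect α), substReflect_substReflect,
    ← mul_assoc]
  rfl

theorem quotient_prod {P P' g : K[X]} (hg : g * substReflect α g = X * (C (2 * α) - X))
    (h : P' ∣ g * substReflect α P) (h' : P ∣ g * substReflect α P') :
    HasReflection α ((K[X] ⧸ Ideal.span {P}) × (K[X] ⧸ Ideal.span {P'})) := by
  refine ⟨⟨⟨fun m => (quotMul (substReflect α) g h' m.2, quotMul (substReflect α) g h m.1),
    fun x y => ?_⟩, fun c x => ?_⟩, fun m => ?_⟩
  · simp
  · simp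
  · obtain ⟨m, m'⟩ := m
    obtain ⟨f, rfl⟩ := Ideal.Quotient.mk_surjective m
    obtain ⟨f', rfl⟩ := Ideal.Quotient.mk_surjective m'
    simp only [LinearMap.coe_mk, AddHom.coe_mk, quotMul_mk]
    rw [← hg, map_mul (substReflect α), substReflect_substReflect, ← mul_assoc,
      map_mul (substReflect α), substReflect_substReflect, ← mul_assoc]
    rfl

theorem X_mul_substReflect_X (α : K) : X * substReflect α X = X * (C (2 * α) - X) := by
  rw [substReflect_X]

theorem sub_mul_substReflect_sub (α : K) :
    (C (2 * α) - X) * substReflect α (C (2 * α) - X) = X * (C (2 * α) - X) := by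
  rw [map_sub, substReflect_X, substReflect_C]; ring

theorem quotient_pow_prod_pow {k l : ℕ} (h : k ≤ l + 1) (h' : l ≤ k + 1) :
    HasReflection α
      ((K[X] ⧸ Ideal.span {(X - C 0 : K[X]) ^ k}) ×
        (K[X] ⧸ Ideal.span {(X - C (2 * α)) ^ l})) := by
  rw [C_0, sub_zero]
  have e1 : substReflect α (X ^ k) = (C (2 * α) - X) ^ k := by rw [map_pow, substReflect_X]
  have e2 : substReflect α ((X - C (2 * α)) ^ l) = (-X) ^ l := by
    rw [map_pow, map_sub, substReflect_X, substReflect_C]; congr 1; ring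
  have hneg : ∀ {i j : ℕ}, i ≤ j → (X - C (2 * α)) ^ i ∣ (C (2 * α) - X : K[X]) ^ j := by
    intro i j hij
    exact (pow_dvd_pow_of_dvd (dvd_sub_comm.1 dvd_rfl) i).trans (pow_dvd_pow _ hij)
  have hX : ∀ {i j : ℕ}, i ≤ j → (X : K[X]) ^ i ∣ (-X) ^ j := by
    intro i j hij
    exact (pow_dvd_pow_of_dvd (dvd_neg.2 dvd_rfl) i).trans (pow_dvd_pow _ hij)
  -- The substitution exchanges `X` and `X - 2α` up to sign. The factor `g` supplies the single
  -- power missing when passing from the shorter block to the longer one, so it is `X` or `2α - X`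
  -- according to which block is longer.
  rcases le_or_gt l k with hlk | hkl
  · refine quotient_prod (X_mul_substReflect_X α) ?_ ?_
    · rw [e1]; exact (hneg hlk).mul_left _
    · rw [e2]
      refine (pow_dvd_pow _ h).trans ?_
      rw [pow_succ']
      exact mul_dvd_mul_left _ (hX le_rfl)
  · refine quotient_prod (sub_mul_substReflect_sub α) ?_ ?_
    · rw [e1, ← pow_succ']; exact hneg h'
    · rw [e2]; exact (hX hkl.le).mul_left _

theorem quotient_pow (k : ℕ) : HasReflection α (K[X] ⧸ Ideal.span {(X - C α) ^ k}) := by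
  refine quotient (X_mul_substReflect_X α) (Dvd.dvd.mul_left ?_ _)
  rw [map_pow, map_sub, substReflect_X, substReflect_C]
  refine pow_dvd_pow_of_dvd ⟨-1, ?_⟩ k
  rw [map_mul, map_ofNat]; ring

theorem quotient_comp_sq (Q : K[X]) :
    HasReflection α (K[X] ⧸ Ideal.span {Q.comp ((X - C α) ^ 2)}) := by
  refine quotient (X_mul_substReflect_X α) (Dvd.dvd.mul_left (dvd_of_eq ?_) _)
  simp only [substReflect, coe_compRingHom_apply, comp_assoc]
  congr 1
  simp only [pow_comp, sub_comp, X_comp, C_comp, map_mul, map_ofNat]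
  ring

/-- A module killed by a product of coprime polynomials is the product of their torsion parts. -/
theorem torsionBy_mul {f g : K[X]} (hfg : IsCoprime f g)
    (h : HasReflection α (Submodule.torsionBy K[X] M f × Submodule.torsionBy K[X] M g)) :
    HasReflection α (Submodule.torsionBy K[X] M (f * g)) := by
  obtain ⟨a, b, hab⟩ := hfg
  have hle : Submodule.torsionBy K[X] M f ≤ Submodule.torsionBy K[X] M (f * g) :=
    Submodule.torsionBy_le_torsionBy_of_dvd _ _ (dvd_mul_right _ _)
  have hle' : Submodule.torsionBy K[X] M g ≤ Submodule.torsionBy K[X] M (f * g) :=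
    Submodule.torsionBy_le_torsionBy_of_dvd _ _ (dvd_mul_left _ _)
  refine h.congr (LinearEquiv.ofBijective
    ((Submodule.inclusion hle).coprod (Submodule.inclusion hle')) ⟨?_, ?_⟩)
  · rw [← LinearMap.ker_eq_bot, LinearMap.ker_eq_bot']
    rintro ⟨⟨x, hx⟩, ⟨y, hy⟩⟩ h
    rw [Submodule.mem_torsionBy_iff] at hx hy
    have hxy : x + y = 0 := congrArg Subtype.val h
    have hy0 : y = -x := (neg_eq_of_add_eq_zero_right hxy).symm
    have hgx : g • x = 0 := by simpa [hy0] using hy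
    have hx0 : x = 0 := by
      rw [← one_smul K[X] x, ← hab, add_smul, mul_smul, mul_smul, hx, hgx]; simp
    subst hx0
    simp [hy0]
  · rintro ⟨x, hx⟩
    rw [Submodule.mem_torsionBy_iff] at hx
    refine ⟨(⟨(b * g) • x, ?_⟩, ⟨(a * f) • x, ?_⟩), Subtype.ext ?_⟩
    · rw [Submodule.mem_torsionBy_iff, smul_smul, show f * (b * g) = b * (f * g) by ring,
        mul_smul, hx, smul_zero]
    · rw [Submodule.mem_torsionBy_iff, smul_smul, show g * (a * f) = a * (f * g) by ring,
        mul_smul, hx, smul_zero]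
    · change (b * g) • x + (a * f) • x = x
      rw [← add_smul, add_comm, hab, one_smul]

theorem of_isTorsionBy {f : K[X]} (hM : Module.IsTorsionBy K[X] M f)
    (h : HasReflection α (Submodule.torsionBy K[X] M f)) : HasReflection α M :=
  h.congr (LinearEquiv.ofTop _ ((Module.isTorsionBy_iff_torsionBy_eq_top f).1 hM))

end HasReflection

/-! ### Reflections and pairs of idempotents -/

section Composite

variable {E : Type*} [AddCommGroup E] [Module K E]

/-- The idempotents are `(u ± D) / (2α)`: the two relations for `D` give `(u ± D)² = 2α (u ± D)`. -/
theorem HasReflection.isComposite (hK : ringChar K ≠ 2) {α : K} (hα : α ≠ 0)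
    {u : Module.End K E} (h : HasReflection α (Module.AEval' u)) : IsComposite α α u := by
  have h2 : (2 : K) ≠ 0 := Ring.two_ne_zero hK
  obtain ⟨D', hD'⟩ := h
  let o := Module.AEval'.of u
  have hX : ∀ x, (X : K[X]) • o x = o (u x) := Module.AEval'.X_smul_of u
  have hC : ∀ (c : K) (m : Module.AEval' u), C c • m = c • m := Module.AEval.C_smul u
  let D : Module.End K E :=
    { toFun := fun x => o.symm (D' (o x))
      map_add' := by simp
      map_smul' := fun c x => by
        simp only [map_smul, RingHom.id_apply]
        rw [← hC, LinearMap.map_smulₛₗ, substReflect_C, hC, map_smul] }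
  have hDo : ∀ x, o (D x) = D' (o x) := fun x => by simp [D]
  have h1 : ∀ x, D (u x) = (2 * α) • D x - u (D x) := fun x => by
    apply o.injective
    rw [map_sub, map_smul, ← hX, hDo, hDo, ← hX, LinearMap.map_smulₛₗ, substReflect_X, sub_smul, hC]
  have h3 : ∀ x, D (D x) = (2 * α) • u x - u (u x) := fun x => by
    apply o.injective
    rw [hDo, hDo, hD', map_sub, map_smul, mul_sub, sub_smul, mul_comm, mul_smul, hX, mul_smul, hX,
      hX, hC]
  refine ⟨(2 * α)⁻¹ • (u + D), (2 * α)⁻¹ • (u - D), ?_, ?_, ?_⟩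
  · ext x
    have h0 : (2 * α) ≠ 0 := mul_ne_zero h2 hα
    simp only [Module.End.mul_apply, LinearMap.smul_apply, LinearMap.add_apply, map_smul, map_add,
      h1, h3]
    have : u (u x) + ((2 * α) • D x - u (D x)) + (u (D x) + ((2 * α) • u x - u (u x)))
      = (2 * α) • (u x + D x) := by rw [smul_add]; abel
    rw [← smul_add, this, inv_smul_smul₀ h0]
  · ext x
    have h0 : (2 * α) ≠ 0 := mul_ne_zero h2 hα
    simp only [Module.End.mul_apply, LinearMap.smul_apply, LinearMap.sub_apply, map_smul, map_sub,
      h1, h3]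
    have : u (u x) - ((2 * α) • D x - u (D x)) - (u (D x) - ((2 * α) • u x - u (u x)))
      = (2 * α) • (u x - D x) := by rw [smul_sub]; abel
    rw [← smul_sub, this, inv_smul_smul₀ h0]
  · ext x
    simp only [LinearMap.smul_apply, LinearMap.sub_apply, LinearMap.add_apply]
    rw [smul_smul, smul_smul, ← smul_add, show u x + D x + (u x - D x) = (2 : K) • u x by
      rw [two_smul]; abel, smul_smul]
    rw [show α * (2 * α)⁻¹ * 2 = 1 by field_simp, one_smul]

/-- The operator `α (p - q)` attached to a composite `α p + α q`, written in terms of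
`v = α p + α q - α`. -/
theorem IsComposite.exists_anticommuting {α : K} {u : Module.End K E} (h : IsComposite α α u) :
    ∃ D : Module.End K E, (∀ x, D (u x - α • x) = -(u (D x) - α • D x)) ∧
      ∀ x, D (D x) = (2 * α) • u x - u (u x) := by
  obtain ⟨p, q, hp, hq, rfl⟩ := h
  have hp' : ∀ x, p (p x) = p x := fun x => LinearMap.congr_fun hp x
  have hq' : ∀ x, q (q x) = q x := fun x => LinearMap.congr_fun hq x
  refine ⟨α • p - α • q, fun x => ?_, fun x => ?_⟩ <;>
  · simp only [LinearMap.sub_apply, LinearMap.add_apply, LinearMap.smul_apply, map_sub, map_add,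
      map_smul, hp', hq']
    module

end Composite

end Reflection

/-! ### Jordan blocks and their sizes -/

section JordanBlocks

variable {K E : Type*} [Field K] [AddCommGroup E] [Module K E]

theorem mem_ker_pow_iff_smul_eq_zero (u : Module.End K E) (s : K) (k : ℕ) (x : E) :
    x ∈ LinearMap.ker ((u - algebraMap K (Module.End K E) s) ^ k) ↔
      ((X - C s) ^ k : K[X]) • Module.AEval'.of u x = 0 := by
  rw [← Module.AEval.of_aeval_smul, LinearEquiv.map_eq_zero_iff, LinearMap.mem_ker]
  simp

theorem finrank_quotient_X_sub_C_pow (s : K) (m : ℕ) :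
    Module.finrank K (K[X] ⧸ Ideal.span {(X - C s) ^ m}) = m := by
  rw [finrank_quotient_span_eq_natDegree, natDegree_pow, natDegree_X_sub_C, mul_one]

/-- In a block of size `l`, the elements killed by `(X - s)^k` are the multiples of `(X - s)^(l -
min k l)`, a copy of a block of size `min k l`. -/
theorem finrank_ker_pow_eq_sum_min (u : Module.End K E) {s : K} {N n k : ℕ} {l : Fin n → ℕ}
    (e : Submodule.torsionBy K[X] (Module.AEval' u) ((X - C s) ^ N) ≃ₗ[K[X]]
      ((i : Fin n) → K[X] ⧸ Ideal.span {(X - C s) ^ l i}))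
    (hN : LinearMap.ker ((u - algebraMap K (Module.End K E) s) ^ k) ≤
      LinearMap.ker ((u - algebraMap K (Module.End K E) s) ^ N)) :
    Module.finrank K (LinearMap.ker ((u - algebraMap K (Module.End K E) s) ^ k)) =
      ∑ i, min k (l i) := by
  have h0 : ∀ j, (X - C s : K[X]) ^ j ≠ 0 := fun j => pow_ne_zero _ (X_sub_C_ne_zero s)
  let q : ∀ i, (K[X] ⧸ Ideal.span {(X - C s : K[X]) ^ min k (l i)}) →ₗ[K[X]]
      (K[X] ⧸ Ideal.span {(X - C s : K[X]) ^ l i}) := fun i =>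
    quotMul (RingHom.id K[X]) ((X - C s) ^ (l i - min k (l i))) (by
      rw [RingHom.id_apply, ← pow_add, Nat.sub_add_cancel (min_le_right _ _)])
  have hq : ∀ i f, q i (Ideal.Quotient.mk _ f) =
      Ideal.Quotient.mk _ ((X - C s) ^ (l i - min k (l i)) * f) := fun i f => rfl
  have hinj : ∀ i, Function.Injective (q i) := fun i => by
    rw [← LinearMap.ker_eq_bot, LinearMap.ker_eq_bot']
    intro m hm
    obtain ⟨f, rfl⟩ := Ideal.Quotient.mk_surjective m
    rw [hq, Ideal.Quotient.eq_zero_iff_mem, Ideal.mem_span_singleton,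
      show (X - C s : K[X]) ^ l i = (X - C s) ^ (l i - min k (l i)) * (X - C s) ^ min k (l i) by
        rw [← pow_add, Nat.sub_add_cancel (min_le_right _ _)],
      mul_dvd_mul_iff_left (h0 _)] at hm
    rwa [Ideal.Quotient.eq_zero_iff_mem, Ideal.mem_span_singleton]
  have hran : ∀ i y, ((X - C s) ^ k : K[X]) • y = 0 → ∃ x, q i x = y := fun i y hy => by
    obtain ⟨g, rfl⟩ := Ideal.Quotient.mk_surjective y
    have hy' : (X - C s : K[X]) ^ l i ∣ (X - C s) ^ k * g := by
      rwa [← Ideal.mem_span_singleton, ← Ideal.Quotient.eq_zero_iff_mem]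
    have hg : (X - C s : K[X]) ^ (l i - min k (l i)) ∣ g := by
      rcases le_total k (l i) with h | h
      · rw [min_eq_left h]
        rw [← Nat.add_sub_cancel' h, pow_add, mul_dvd_mul_iff_left (h0 _)] at hy'
        simpa using hy'
      · simp [min_eq_right h]
    obtain ⟨f, rfl⟩ := hg
    exact ⟨Ideal.Quotient.mk _ f, rfl⟩
  have hzero : ∀ i x, ((X - C s) ^ k : K[X]) • q i x = 0 := fun i x => by
    obtain ⟨f, rfl⟩ := Ideal.Quotient.mk_surjective x
    rw [← map_smul]
    change q i (Ideal.Quotient.mk _ ((X - C s) ^ k * f)) = 0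
    rw [show Ideal.Quotient.mk (Ideal.span {(X - C s : K[X]) ^ min k (l i)})
      ((X - C s) ^ k * f) = 0 by
        rw [Ideal.Quotient.eq_zero_iff_mem, Ideal.mem_span_singleton]
        exact (pow_dvd_pow _ (min_le_left _ _)).mul_right _, map_zero]
  let Q : ((i : Fin n) → K[X] ⧸ Ideal.span {(X - C s : K[X]) ^ min k (l i)}) →ₗ[K[X]]
      Module.AEval' u := (Submodule.subtype _).comp (e.symm.toLinearMap.comp
        (LinearMap.pi fun i => (q i).comp (LinearMap.proj i)))
  let Q' := (Module.AEval'.of u).symm.toLinearMap.comp (Q.restrictScalars K)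
  have hQinj : Function.Injective Q' := by
    refine (Module.AEval'.of u).symm.injective.comp (Subtype.val_injective.comp
      (e.symm.injective.comp ?_))
    intro x y hxy
    funext i
    exact hinj i (congrFun hxy i)
  have hrange : LinearMap.range Q' =
      LinearMap.ker ((u - algebraMap K (Module.End K E) s) ^ k) := by
    ext x
    constructor
    · rintro ⟨y, rfl⟩
      rw [mem_ker_pow_iff_smul_eq_zero]
      change ((X - C s) ^ k : K[X]) • Q y = 0
      rw [← map_smul]
      change ((e.symm (fun i => q i (((X - C s) ^ k : K[X]) • y i)) :
        Submodule.torsionBy K[X] (Module.AEval' u) ((X - C s) ^ N)) : Module.AEval' u) = 0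
      simp only [map_smul, hzero]
      rw [show (fun i => (0 : K[X] ⧸ Ideal.span {(X - C s : K[X]) ^ l i})) = 0 from rfl, map_zero]
      rfl
    · intro hx
      have hxN := hN hx
      rw [mem_ker_pow_iff_smul_eq_zero] at hx hxN
      let z : Submodule.torsionBy K[X] (Module.AEval' u) ((X - C s) ^ N) :=
        ⟨Module.AEval'.of u x, hxN⟩
      have hz : ((X - C s) ^ k : K[X]) • z = 0 := Subtype.ext hx
      have hez : ∀ i, ((X - C s) ^ k : K[X]) • e z i = 0 := fun i => by
        rw [← Pi.smul_apply, ← map_smul, hz, map_zero]; rfl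
      choose y hy using fun i => hran i _ (hez i)
      refine ⟨y, ?_⟩
      apply (Module.AEval'.of u).injective
      change ((e.symm (fun i => q i (y i)) :
        Submodule.torsionBy K[X] (Module.AEval' u) ((X - C s) ^ N)) : Module.AEval' u) = _
      rw [show (fun i => q i (y i)) = e z from funext hy, e.symm_apply_apply]
  have : ∀ i, Module.Finite K (K[X] ⧸ Ideal.span {(X - C s : K[X]) ^ min k (l i)}) := fun i =>
    ((monic_X_sub_C s).pow _).finite_quotient
  rw [← hrange, LinearMap.finrank_range_of_inj hQinj, Module.finrank_pi_fintype]
  simp only [finrank_quotient_X_sub_C_pow]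

theorem jordanCount_eq_card {n : ℕ} {l : Fin n → ℕ} {u : Module.End K E} {s : K}
    (h : ∀ k, Module.finrank K (LinearMap.ker ((u - algebraMap K (Module.End K E) s) ^ k)) =
      ∑ i, min k (l i)) {k : ℕ} (hk : 1 ≤ k) :
    jordanCount u s k = (Finset.univ.filter fun i => k ≤ l i).card := by
  rw [jordanCount, h, h, Finset.card_filter]
  push_cast
  rw [← Finset.sum_sub_distrib]
  refine Finset.sum_congr rfl fun i _ => ?_
  split_ifs <;> omega

/-- If `l i ≥ m i + 2`, then all `i + 1` indices up to `i` have `l ≥ m i + 2`, while only the `i`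
indices before `i` can have `m ≥ m i + 1`; this contradicts the hypothesis at `k = m i + 1`. -/
theorem le_add_one_of_card_le {n : ℕ} {l m : Fin n → ℕ} (hl : Antitone l) (hm : Antitone m)
    (h : ∀ k, 1 ≤ k → (Finset.univ.filter fun i => k + 1 ≤ l i).card ≤
      (Finset.univ.filter fun i => k ≤ m i).card) (i : Fin n) : l i ≤ m i + 1 := by
  by_contra! hlt
  have h1 : Finset.Iic i ⊆ Finset.univ.filter fun j => m i + 1 + 1 ≤ l j := fun j hj => by
    have := hl (Finset.mem_Iic.1 hj)
    simp only [Finset.mem_filter, Finset.mem_univ, true_and]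
    omega
  have h2 : (Finset.univ.filter fun j => m i + 1 ≤ m j) ⊆ Finset.Iio i := fun j hj => by
    simp only [Finset.mem_filter, Finset.mem_univ, true_and] at hj
    rw [Finset.mem_Iio]
    by_contra! hij
    have := hm hij
    omega
  have h3 := Finset.card_le_card h1
  have h4 := Finset.card_le_card h2
  have h5 := h (m i + 1) (Nat.le_add_left _ _)
  rw [Fin.card_Iic] at h3
  rw [Fin.card_Iio] at h4
  omega

theorem isTorsion_torsionBy {M : Type*} [AddCommGroup M] [Module K[X] M] {f : K[X]} (hf : f ≠ 0) :
    Module.IsTorsion K[X] (Submodule.torsionBy K[X] M f) := fun {x} =>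
  ⟨⟨f, mem_nonZeroDivisors_of_ne_zero hf⟩, Submodule.smul_torsionBy f x⟩

theorem dvd_of_isTorsionBy_of_equiv {R M : Type*} [CommRing R] [AddCommGroup M] [Module R M]
    {c : R} (hc : Module.IsTorsionBy R M c) {n : ℕ} {P : Fin n → R}
    (e : M ≃ₗ[R] ((i : Fin n) → R ⧸ Ideal.span {P i})) (i : Fin n) : P i ∣ c := by
  have h1 : c • (Pi.single i (Ideal.Quotient.mk _ 1) :
      (i : Fin n) → R ⧸ Ideal.span {P i}) = 0 := by
    rw [← e.apply_symm_apply (Pi.single i _), ← map_smul, hc, map_zero]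
  have h2 := congrFun h1 i
  rw [Pi.smul_apply, Pi.single_eq_same] at h2
  have h3 : Ideal.Quotient.mk (Ideal.span {P i}) (c * 1) = 0 := h2
  rwa [mul_one, Ideal.Quotient.eq_zero_iff_mem, Ideal.mem_span_singleton] at h3

/-- Invariant factors dividing a prime power are themselves powers of that prime. Exponent zero is
allowed, so that families for two eigenvalues can be given the same length. -/
theorem exists_jordan_blocks {M : Type*} [AddCommGroup M] [Module K[X] M] [Module.Finite K[X] M]
    (s : K) (N : ℕ) :
    ∃ n₀, ∀ n, n₀ ≤ n → ∃ l : Fin n → ℕ, Antitone l ∧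
      Nonempty (Submodule.torsionBy K[X] M ((X - C s) ^ N) ≃ₗ[K[X]]
        ((i : Fin n) → K[X] ⧸ Ideal.span {(X - C s) ^ l i})) := by
  obtain ⟨n₀, h⟩ := exists_divisibility_chain_of_isTorsion
    (isTorsion_torsionBy (M := M) (pow_ne_zero N (X_sub_C_ne_zero s)))
  refine ⟨n₀, fun n hn => ?_⟩
  obtain ⟨P, hP, ⟨e⟩⟩ := h n hn
  have hdvd : ∀ i, P i ∣ (X - C s) ^ N :=
    dvd_of_isTorsionBy_of_equiv (Submodule.torsionBy_isTorsionBy _) e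
  choose l _ hl using fun i => (dvd_prime_pow (prime_X_sub_C s) N).1 (hdvd i)
  refine ⟨l, fun i j hij => ?_, ⟨e ≪≫ₗ LinearEquiv.piCongrRight fun i =>
    Submodule.quotEquivOfEq _ _ (Ideal.span_singleton_eq_span_singleton.2 (hl i))⟩⟩
  refine (pow_dvd_pow_iff (X_sub_C_ne_zero s) (not_isUnit_X_sub_C s)).1 ?_
  exact ((hl j).symm.dvd.trans (hP i j hij)).trans (hl i).dvd

end JordanBlocks

/-! ### Splitting off prescribed roots of a polynomial -/

section RootSplitting

variable {K : Type*} [Field K]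

theorem rootsPart_monic (S : Set K) (p : K[X]) : (rootsPart S p).Monic :=
  monic_multiset_prod_of_monic _ _ fun a _ => monic_X_sub_C a

theorem rootsPart_dvd (S : Set K) (p : K[X]) : rootsPart S p ∣ p := by
  classical
  exact (Multiset.prod_dvd_prod_of_le
    (Multiset.map_le_map (Multiset.filter_le _ _))).trans (prod_multiset_X_sub_C_dvd p)

theorem rootsPart_mul_rootFreePart (S : Set K) (p : K[X]) :
    rootsPart S p * rootFreePart S p = p := by
  have h := modByMonic_add_div p (rootsPart S p)
  rwa [(modByMonic_eq_zero_iff_dvd (rootsPart_monic S p)).2 (rootsPart_dvd S p), zero_add] at h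

theorem not_isRoot_rootFreePart {S : Set K} {p : K[X]} (hp : p ≠ 0) {a : K} (ha : a ∈ S) :
    ¬ (rootFreePart S p).IsRoot a := by
  classical
  have h := rootsPart_mul_rootFreePart S p
  have hne : rootsPart S p * rootFreePart S p ≠ 0 := h.symm ▸ hp
  have h1 := roots_mul hne
  rw [h] at h1
  have h2 : (rootsPart S p).roots = p.roots.filter (fun a => a ∈ S) := by
    rw [rootsPart, roots_multiset_prod_X_sub_C]
  intro hr
  have h3 : a ∈ (rootFreePart S p).roots := (mem_roots (right_ne_zero_of_mul hne)).2 hr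
  have h4 := congrArg (Multiset.count a) h1
  rw [Multiset.count_add, h2, Multiset.count_filter_of_pos ha] at h4
  have := Multiset.count_pos.2 h3
  omega

theorem isCoprime_X_sub_C_of_not_isRoot {p : K[X]} {a : K} (h : ¬ p.IsRoot a) :
    IsCoprime (X - C a) p :=
  ((irreducible_X_sub_C a).coprime_iff_not_dvd).2 fun hd => h (dvd_iff_isRoot.1 hd)

/-- One uniform exponent replaces the individual multiplicities of the roots. -/
theorem rootsPart_dvd_pow {S : Set K} {p T : K[X]} (hT : ∀ a ∈ S, X - C a ∣ T) {m : ℕ}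
    (hm : p.roots.card ≤ m) : rootsPart S p ∣ T ^ m := by
  classical
  have key : ∀ s : Multiset K, (∀ a ∈ s, a ∈ S) →
      (s.map fun a => X - C a).prod ∣ T ^ Multiset.card s := by
    intro s
    induction s using Multiset.induction with
    | empty => simp
    | cons a s ih =>
      intro hs
      rw [Multiset.map_cons, Multiset.prod_cons, Multiset.card_cons, pow_succ']
      exact mul_dvd_mul (hT a (hs a (Multiset.mem_cons_self _ _)))
        (ih fun b hb => hs b (Multiset.mem_cons_of_mem hb))
  refine (key _ fun a ha => (Multiset.mem_filter.1 ha).2).trans (pow_dvd_pow _ ?_)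
  refine le_trans (Multiset.card_le_card ?_) hm
  exact Multiset.filter_le _ _

end RootSplitting

/-! ### Sufficiency of the two conditions -/

section Sufficiency

variable {K E : Type*} [Field K] [AddCommGroup E] [Module K E]

theorem nonempty_aeval_awayPart_equiv (S : Set K) (u : Module.End K E) :
    Nonempty (Module.AEval' (awayPart S u) ≃ₗ[K[X]]
      Submodule.torsionBy K[X] (Module.AEval' u) (rootFreePart S (minpoly K u))) := by
  have hmem : ∀ x : E, Module.AEval'.of u x ∈
      Submodule.torsionBy K[X] (Module.AEval' u) (rootFreePart S (minpoly K u)) ↔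
      x ∈ awaySubspace S u := fun x => by
    rw [Submodule.mem_torsionBy_iff, ← Module.AEval.of_aeval_smul, LinearEquiv.map_eq_zero_iff]
    rfl
  let f : awaySubspace S u →ₗ[K]
      Submodule.torsionBy K[X] (Module.AEval' u) (rootFreePart S (minpoly K u)) :=
    { toFun := fun x => ⟨Module.AEval'.of u x, (hmem x).2 x.2⟩
      map_add' := fun x y => rfl
      map_smul' := fun c x => rfl }
  refine ⟨LinearEquiv.ofAEval _ (LinearEquiv.ofBijective f ⟨fun x y hxy => ?_, fun y => ?_⟩) ?_⟩
  · exact Subtype.ext ((Module.AEval'.of u).injective (congrArg Subtype.val hxy))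
  · exact ⟨⟨(Module.AEval'.of u).symm y, (hmem _).1 (by simp)⟩, Subtype.ext rfl⟩
  · intro x
    exact Subtype.ext (Module.AEval'.X_smul_of u x).symm

theorem isTorsionBy_aeval_of_minpoly_dvd {u : Module.End K E} {f : K[X]} (h : minpoly K u ∣ f) :
    Module.IsTorsionBy K[X] (Module.AEval' u) f := fun {x} => by
  have hf : aeval u f = 0 := by
    obtain ⟨g, rfl⟩ := h
    simp
  have := (Module.AEval'.of u).apply_symm_apply x
  rw [← this, ← Module.AEval.of_aeval_smul, hf, zero_smul, map_zero]

theorem hasReflection_of_intertwined [FiniteDimensional K E] (hK : ringChar K ≠ 2) {α : K}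
    (hα : α ≠ 0) {u : Module.End K E}
    (hI : Intertwined (jordanCount u 0) (jordanCount u (2 * α))) {N : ℕ} {P : Fin N → K[X]}
    (hP : IsElementaryFactors (awayPart {0, α, 2 * α} u) P)
    (hPQ : ∀ i, ∃ Q : K[X], P i = Q.comp ((X - C α) ^ 2)) :
    HasReflection α (Module.AEval' u) := by
  have h2 : (2 : K) ≠ 0 := Ring.two_ne_zero hK
  have hμ : minpoly K u ≠ 0 := minpoly.ne_zero (Algebra.IsIntegral.isIntegral u)
  set S : Set K := {0, α, 2 * α} with hS
  set Q := rootFreePart S (minpoly K u) with hQ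
  -- The dimension makes the kernels of powers stationary from `m` on; the number of roots makes `m`
  -- bound every multiplicity in the minimal polynomial.
  set m := max (Module.finrank K E) (minpoly K u).roots.card with hm
  have hstab : ∀ s k, LinearMap.ker ((u - algebraMap K (Module.End K E) s) ^ k) ≤
      LinearMap.ker ((u - algebraMap K (Module.End K E) s) ^ m) := fun s k =>
    (Module.End.ker_pow_le_ker_pow_finrank _ k).trans
      (fun x hx => Module.End.pow_map_zero_of_le (le_max_left _ _) hx)
  have hcop : ∀ a ∈ S, IsCoprime (X - C a) Q := fun a ha =>
    isCoprime_X_sub_C_of_not_isRoot (not_isRoot_rootFreePart hμ ha)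
  have h0S : (0 : K) ∈ S := by simp [hS]
  have hαS : α ∈ S := by simp [hS]
  have h2S : 2 * α ∈ S := by simp [hS]
  have hpair : ∀ {a b : K}, a ≠ b → IsCoprime ((X - C a) ^ m : K[X]) ((X - C b) ^ m) :=
    fun hab => (isCoprime_X_sub_C_of_isUnit_sub (sub_ne_zero.2 hab).isUnit).pow
  have hdvd : minpoly K u ∣ ((X - C 0) ^ m * (X - C (2 * α)) ^ m * (X - C α) ^ m) * Q := by
    rw [← rootsPart_mul_rootFreePart S (minpoly K u)]
    refine mul_dvd_mul ?_ dvd_rfl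
    rw [← mul_pow, ← mul_pow]
    refine rootsPart_dvd_pow ?_ (le_max_right _ _)
    rintro a (rfl | rfl | rfl)
    · exact (dvd_mul_right _ _).mul_right _
    · exact dvd_mul_left _ _
    · exact (dvd_mul_left _ _).mul_right _
  obtain ⟨n₀, hn₀⟩ := exists_jordan_blocks (M := Module.AEval' u) (0 : K) m
  obtain ⟨n₁, hn₁⟩ := exists_jordan_blocks (M := Module.AEval' u) (2 * α) m
  obtain ⟨n₂, hn₂⟩ := exists_jordan_blocks (M := Module.AEval' u) α m
  -- A common length lets the sorted blocks at `0` and `2α` be paired index by index.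
  obtain ⟨l₀, hl₀, ⟨e₀⟩⟩ := hn₀ (max n₀ n₁) (le_max_left _ _)
  obtain ⟨l₁, hl₁, ⟨e₁⟩⟩ := hn₁ (max n₀ n₁) (le_max_right _ _)
  obtain ⟨l₂, hl₂, ⟨e₂⟩⟩ := hn₂ n₂ le_rfl
  have hc₀ := fun k (hk : 1 ≤ k) => jordanCount_eq_card
    (fun k => finrank_ker_pow_eq_sum_min u e₀ (hstab 0 k)) hk
  have hc₁ := fun k (hk : 1 ≤ k) => jordanCount_eq_card
    (fun k => finrank_ker_pow_eq_sum_min u e₁ (hstab (2 * α) k)) hk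
  have hle : ∀ i, l₀ i ≤ l₁ i + 1 := le_add_one_of_card_le hl₀ hl₁ fun k hk => by
    have := (hI k hk).2
    rw [hc₀ _ (by omega), hc₁ _ hk] at this
    exact_mod_cast this
  have hle' : ∀ i, l₁ i ≤ l₀ i + 1 := le_add_one_of_card_le hl₁ hl₀ fun k hk => by
    have := (hI k hk).1
    rw [hc₁ _ (by omega), hc₀ _ hk] at this
    exact_mod_cast this
  have hT02 : HasReflection α (Submodule.torsionBy K[X] (Module.AEval' u)
      ((X - C 0) ^ m * (X - C (2 * α)) ^ m)) := by
    refine HasReflection.torsionBy_mul (hpair (mul_ne_zero h2 hα).symm)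
      ((HasReflection.pi_prod fun i => ?_).congr (LinearEquiv.prodCongr e₀ e₁).symm)
    exact HasReflection.quotient_pow_prod_pow (hle i) (hle' i)
  have hTα : HasReflection α (Submodule.torsionBy K[X] (Module.AEval' u) ((X - C α) ^ m)) :=
    (HasReflection.pi fun i => HasReflection.quotient_pow (l₂ i)).congr e₂.symm
  have hTQ : HasReflection α (Submodule.torsionBy K[X] (Module.AEval' u) Q) := by
    obtain ⟨e⟩ := hP.2.2
    obtain ⟨f⟩ := nonempty_aeval_awayPart_equiv S u
    refine (HasReflection.pi fun i => ?_).congr (e.symm ≪≫ₗ f)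
    obtain ⟨R, hR⟩ := hPQ i
    rw [hR]
    exact HasReflection.quotient_comp_sq R
  refine HasReflection.of_isTorsionBy (isTorsionBy_aeval_of_minpoly_dvd hdvd)
    (HasReflection.torsionBy_mul ?_
      ((HasReflection.torsionBy_mul ?_ (hT02.prod hTα)).prod hTQ))
  · exact (((hcop 0 h0S).pow_left).mul_left ((hcop _ h2S).pow_left)).mul_left
      ((hcop α hαS).pow_left)
  · refine (hpair hα.symm).mul_left (hpair ?_)
    intro h
    exact hα (by linear_combination h)

end Sufficiency

/-! ### Necessity of the intertwining condition -/

section Intertwining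

variable {K E : Type*} [Field K] [AddCommGroup E] [Module K E]

/-- If `f` induces an injection `A' ⧸ A → B' ⧸ B`, then `dim A' - dim A ≤ dim B' - dim B`. -/
theorem finrank_add_finrank_le_of_map [FiniteDimensional K E] (f : E →ₗ[K] E)
    {A A' B B' : Submodule K E} (hB : B ≤ B')
    (hf : ∀ x ∈ A', f x ∈ B') (hinj : ∀ x ∈ A', f x ∈ B → x ∈ A) :
    Module.finrank K A' + Module.finrank K B ≤ Module.finrank K B' + Module.finrank K A := by
  have h1 := LinearMap.finrank_range_add_finrank_ker ((B.mkQ.comp f).domRestrict A')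
  have h2 := LinearMap.finrank_range_add_finrank_ker (B.mkQ.domRestrict B')
  have h3 : LinearMap.ker (B.mkQ.domRestrict B') = B.comap B'.subtype := by
    ext x; simp
  rw [h3, (Submodule.comapSubtypeEquivOfLe hB).finrank_eq] at h2
  have h4 : LinearMap.range ((B.mkQ.comp f).domRestrict A') ≤
      LinearMap.range (B.mkQ.domRestrict B') := by
    rintro _ ⟨x, rfl⟩
    exact ⟨⟨f x, hf x x.2⟩, rfl⟩
  have h5 : (LinearMap.ker ((B.mkQ.comp f).domRestrict A')).map A'.subtype ≤ A := by
    rintro _ ⟨x, hx, rfl⟩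
    exact hinj x x.2 (by simpa using hx)
  have h6 := Submodule.finrank_mono h4
  have h7 := Submodule.finrank_mono h5
  rw [Submodule.finrank_map_subtype_eq] at h7
  omega

theorem mem_ker_pow_of_anticommute {a b D : Module.End K E} (h : ∀ x, D (b x) = -a (D x)) (k : ℕ) :
    ∀ x ∈ LinearMap.ker (b ^ k), D x ∈ LinearMap.ker (a ^ k) := by
  induction k with
  | zero =>
    intro x hx
    have hx' : x = 0 := by simpa using hx
    simp [hx']
  | succ k ih =>
    intro x hx
    rw [LinearMap.mem_ker, pow_succ, Module.End.mul_apply] at hx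
    have := ih (b x) hx
    rw [h, neg_mem_iff, LinearMap.mem_ker] at this
    rw [LinearMap.mem_ker, pow_succ, Module.End.mul_apply, this]

/-- Since `a = b + c` with `c ≠ 0`, `D² = -ab` lowers the level in the kernels of powers of `a` or
`b` by exactly one: `hsq_a` and `hsq_b` give at least one, `hinv_a` and `hinv_b` at most one from
level two up. But `D` alone may keep or lower the level, so the quotient of `Ker b^(j+2)` by `Ker
b^(j+1)` is cut in two by `B'`. -/
theorem finrank_ker_pow_le_of_anticommute [FiniteDimensional K E] {a b D : Module.End K E} {c : K}
    (hc : c ≠ 0)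
    (hab : ∀ x, a x = b x + c • x) (hb : ∀ x, D (b x) = -a (D x)) (ha : ∀ x, D (a x) = -b (D x))
    (hD : ∀ x, D (D x) = -a (b x)) (j : ℕ) :
    Module.finrank K (LinearMap.ker (b ^ (j + 2))) + Module.finrank K (LinearMap.ker (a ^ j)) ≤
      Module.finrank K (LinearMap.ker (a ^ (j + 1))) +
        Module.finrank K (LinearMap.ker (b ^ (j + 1))) := by
  have hDb := mem_ker_pow_of_anticommute hb
  have hDa := mem_ker_pow_of_anticommute ha
  have hcomm : ∀ x, a (b x) = b (a x) := fun x => by simp [hab]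
  have hsucc : ∀ (f : Module.End K E) (k : ℕ) x,
      x ∈ LinearMap.ker (f ^ (k + 1)) ↔ f x ∈ LinearMap.ker (f ^ k) := fun f k x => by
    rw [LinearMap.mem_ker, LinearMap.mem_ker, pow_succ, Module.End.mul_apply]
  have hmono : ∀ (f : Module.End K E) (k : ℕ),
      LinearMap.ker (f ^ k) ≤ LinearMap.ker (f ^ (k + 1)) := fun f k x hx =>
    Module.End.pow_map_zero_of_le (Nat.le_succ k) hx
  have hstab : ∀ (f : Module.End K E) (k : ℕ) x,
      x ∈ LinearMap.ker (f ^ k) → f x ∈ LinearMap.ker (f ^ k) := fun f k x hx =>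
    (hsucc f k x).1 (hmono f k hx)
  have hsq_b : ∀ k x, x ∈ LinearMap.ker (b ^ (k + 1)) → D (D x) ∈ LinearMap.ker (b ^ k) :=
    fun k x hx => by
      rw [hD, neg_mem_iff, hab]
      exact Submodule.add_mem _ (hstab b k _ ((hsucc b k x).1 hx))
        (Submodule.smul_mem _ _ ((hsucc b k x).1 hx))
  have hsq_a : ∀ k x, x ∈ LinearMap.ker (a ^ (k + 1)) → D (D x) ∈ LinearMap.ker (a ^ k) :=
    fun k x hx => by
      rw [hD, neg_mem_iff, hcomm, ← sub_eq_iff_eq_add.2 (hab (a x))]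
      exact Submodule.sub_mem _ (hstab a k _ ((hsucc a k x).1 hx))
        (Submodule.smul_mem _ _ ((hsucc a k x).1 hx))
  have hinv_b : ∀ k x, x ∈ LinearMap.ker (b ^ (k + 2)) → D (D x) ∈ LinearMap.ker (b ^ k) →
      x ∈ LinearMap.ker (b ^ (k + 1)) := fun k x hx h => by
    rw [hsucc]
    rw [hD, neg_mem_iff, hab] at h
    have h1 : b (b x) ∈ LinearMap.ker (b ^ k) := by rwa [← hsucc, ← hsucc]
    have h2 := (Submodule.add_mem_iff_right _ h1).1 h
    exact (Submodule.smul_mem_iff _ hc).1 h2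
  have hinv_a : ∀ k x, x ∈ LinearMap.ker (a ^ (k + 2)) → D (D x) ∈ LinearMap.ker (a ^ k) →
      x ∈ LinearMap.ker (a ^ (k + 1)) := fun k x hx h => by
    rw [hsucc]
    rw [hD, neg_mem_iff, hcomm, ← sub_eq_iff_eq_add.2 (hab (a x))] at h
    have h1 : a (a x) ∈ LinearMap.ker (a ^ k) := by rwa [← hsucc, ← hsucc]
    have h2 := (Submodule.sub_mem_iff_right _ h1).1 h
    exact (Submodule.smul_mem_iff _ hc).1 h2
  let B' := LinearMap.ker (b ^ (j + 2)) ⊓ (LinearMap.ker (a ^ (j + 1))).comap D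
  let A' := LinearMap.ker (a ^ (j + 1)) ⊓ (LinearMap.ker (b ^ j)).comap D
  -- `D` embeds `B'` modulo its part in `Ker b^(j+1)` into `Ker a^(j+1) / A'`.
  have h1 : Module.finrank K B' + Module.finrank K A' ≤
      Module.finrank K (LinearMap.ker (a ^ (j + 1))) +
        Module.finrank K (LinearMap.ker (b ^ (j + 1))) :=
    finrank_add_finrank_le_of_map D inf_le_left (fun x hx => hx.2)
      fun x hx hx' => hinv_b j x hx.1 hx'.2
  -- `D³` embeds `Ker b^(j+2) / B'` into `A' / Ker a^j`. In the sum with `h1` the dimensions of `A'`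
  -- and `B'` cancel.
  have h2 : Module.finrank K (LinearMap.ker (b ^ (j + 2))) +
      Module.finrank K (LinearMap.ker (a ^ j)) ≤ Module.finrank K A' + Module.finrank K B' := by
    refine finrank_add_finrank_le_of_map (D * D * D) (le_inf (hmono a j) (hDa j))
      (fun x hx => ⟨?_, ?_⟩) fun x hx hx' => ⟨hx, ?_⟩
    · exact hsq_a (j + 1) _ (hDb (j + 2) x hx)
    · exact hsq_b j _ (hsq_b (j + 1) x hx)
    · exact hinv_a j _ (hDb (j + 2) x hx) hx'
  omega

theorem IsComposite.intertwined [FiniteDimensional K E] (hK : ringChar K ≠ 2) {α : K}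
    (hα : α ≠ 0) {u : Module.End K E}
    (h : IsComposite α α u) : Intertwined (jordanCount u 0) (jordanCount u (2 * α)) := by
  have h2 : (2 * α) ≠ 0 := mul_ne_zero (Ring.two_ne_zero hK) hα
  obtain ⟨D, hv, hD⟩ := h.exists_anticommuting
  have hu : ∀ x, D (u x) = (2 * α) • D x - u (D x) := fun x => by
    have := hv x
    rw [map_sub, map_smul, sub_eq_iff_eq_add] at this
    rw [this]
    module
  intro k hk
  obtain ⟨j, rfl⟩ := Nat.exists_eq_add_of_le' hk
  set a := u - algebraMap K (Module.End K E) 0 with ha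
  set b := u - algebraMap K (Module.End K E) (2 * α) with hb
  have hax : ∀ x, a x = u x := fun x => by simp [ha]
  have hbx : ∀ x, b x = u x - (2 * α) • x := fun x => by
    rw [hb, LinearMap.sub_apply, Module.algebraMap_end_apply]
  have hDa : ∀ x, D (a x) = -b (D x) := fun x => by rw [hax, hbx, hu]; abel
  have hDb : ∀ x, D (b x) = -a (D x) := fun x => by
    rw [hax, hbx, map_sub, hu, map_smul]; abel
  have h3 := finrank_ker_pow_le_of_anticommute h2 (a := a) (b := b) (D := D)
    (fun x => by rw [hax, hbx]; abel) hDb hDa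
    (fun x => by rw [hax, hbx, hD, map_sub, map_smul]; abel) j
  have h4 := finrank_ker_pow_le_of_anticommute (neg_ne_zero.2 h2) (a := b) (b := a) (D := D)
    (fun x => by rw [hax, hbx, neg_smul]; abel) hDa hDb
    (fun x => by rw [hax, hbx, hD]; abel) j
  have hja : ∀ k, jordanCount u 0 (k + 1) = (Module.finrank K (LinearMap.ker (a ^ (k + 1))) : ℤ) -
    Module.finrank K (LinearMap.ker (a ^ k)) := fun k => rfl
  have hjb : ∀ k, jordanCount u (2 * α) (k + 1) =
    (Module.finrank K (LinearMap.ker (b ^ (k + 1))) : ℤ) -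
    Module.finrank K (LinearMap.ker (b ^ k)) := fun k => rfl
  rw [hja, hja, hjb, hjb, show j + 1 + 1 = j + 2 from rfl]
  constructor <;> omega

end Intertwining

/-! ### Elementary factors that are polynomials in `(X - α)²` -/

section EvenInvariantFactors

variable {K F : Type*} [Field K] [AddCommGroup F] [Module K F]

theorem aeval_apply_of_intertwining {F' : Type*} [AddCommGroup F'] [Module K F'] (j : F' →ₗ[K] F)
    {y : Module.End K F'} {z : Module.End K F} (h : ∀ x, j (y x) = z (j x)) (f : K[X]) (x : F') :
    j (aeval y f x) = aeval z f (j x) := by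
  induction f using Polynomial.induction_on' with
  | add p q hp hq => simp [hp, hq]
  | monomial n a =>
    have hn : ∀ x, j ((y ^ n) x) = (z ^ n) (j x) := by
      induction n with
      | zero => simp
      | succ n ih => intro x; rw [pow_succ, pow_succ, Module.End.mul_apply, ih, h]; rfl
    simp [aeval_monomial, Module.algebraMap_end_apply, hn]

theorem finrank_pi_quotient {n : ℕ} {P : Fin n → K[X]} (hP : ∀ i, P i ≠ 0) :
    Module.finrank K ((i : Fin n) → K[X] ⧸ Ideal.span {P i}) = ∑ i, (P i).natDegree := by
  have : ∀ i, Module.Finite K (K[X] ⧸ Ideal.span {P i}) := fun i =>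
    (AdjoinRoot.powerBasis (hP i)).finite
  rw [Module.finrank_pi_fintype]
  simp only [finrank_quotient_span_eq_natDegree]

theorem exists_elementaryFactors [FiniteDimensional K F] (y : Module.End K F) :
    ∃ (n : ℕ) (P : Fin n → K[X]), IsElementaryFactors y P := by
  classical
  have hμ : minpoly K y ≠ 0 := minpoly.ne_zero (Algebra.IsIntegral.isIntegral y)
  have hT : Module.IsTorsionBy K[X] (Module.AEval' y) (minpoly K y) :=
    isTorsionBy_aeval_of_minpoly_dvd dvd_rfl
  obtain ⟨n, P, hu, hdvd, ⟨e⟩⟩ := exists_invariant_factors (R := K[X]) (M := Module.AEval' y)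
    (fun {x} => ⟨⟨minpoly K y, mem_nonZeroDivisors_of_ne_zero hμ⟩, @hT x⟩)
  have hP0 : ∀ i, P i ≠ 0 := fun i => ne_zero_of_dvd_ne_zero hμ (dvd_of_isTorsionBy_of_equiv hT e i)
  refine ⟨n, fun i => normalize (P i), fun i => ⟨monic_normalize (hP0 i), ?_⟩,
    fun i j hij => normalize_dvd_iff.2 (dvd_normalize_iff.2 (hdvd i j hij)),
    ⟨e ≪≫ₗ LinearEquiv.piCongrRight fun i => Submodule.quotEquivOfEq _ _
      (Ideal.span_singleton_eq_span_singleton.2 (associated_normalize (P i)))⟩⟩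
  rw [natDegree_pos_iff_degree_pos, degree_normalize]
  exact degree_pos_of_ne_zero_of_nonunit (hP0 i) (hu i)

/-- An endomorphism conjugated by an involution to its reflection through `α`, and for which `α` is
not an eigenvalue, has elementary factors in `K[(X - α) ^ 2]`. -/
theorem exists_even_elementaryFactors [FiniteDimensional K F] (h2 : (2 : K) ≠ 0) {α : K}
    {w z σ : Module.End K F} (hz : ∀ x, z x = w x - α • x) (hσ : ∀ x, σ (σ x) = x)
    (hσz : ∀ x, σ (z x) = -z (σ x)) (hinj : Function.Injective z) :
    ∃ (n : ℕ) (P : Fin n → K[X]), IsElementaryFactors w P ∧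
      ∀ i, ∃ Q : K[X], P i = Q.comp ((X - C α) ^ 2) := by
  -- `F` is the direct sum of `Fp` and `z Fp`, and `z²` preserves `Fp`. So generators of `Fp` under
  -- `z²` generate `F` under `z`, with relations `R i` evaluated at `(X - α)²`.
  let Fp : Submodule K F := LinearMap.ker (σ - 1)
  have hFp : ∀ x, x ∈ Fp ↔ σ x = x := fun x => by
    simp [Fp, sub_eq_zero]
  have hstab : ∀ x ∈ Fp, (z ^ 2) x ∈ Fp := fun x hx => by
    rw [hFp] at hx ⊢
    rw [pow_two, Module.End.mul_apply, hσz, hσz, hx, map_neg, neg_neg]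
  let y : Module.End K Fp := (z ^ 2).restrict hstab
  obtain ⟨n, R, hR⟩ := exists_elementaryFactors y
  obtain ⟨hmon, hdvd, ⟨e⟩⟩ := hR
  have hdeg : ((X - C α) ^ 2 : K[X]).natDegree = 2 := by
    rw [natDegree_pow, natDegree_X_sub_C]
  have hcomp : ∀ f : K[X], aeval w (f.comp ((X - C α) ^ 2)) = aeval (z ^ 2) f := fun f => by
    rw [aeval_comp]
    congr 2
    ext x
    simp [pow_two, hz, Module.algebraMap_end_apply]
  have hy : ∀ (f : K[X]) (x : Fp), ((aeval y f x : Fp) : F) = aeval (z ^ 2) f x :=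
    aeval_apply_of_intertwining Fp.subtype fun x => rfl
  let P : Fin n → K[X] := fun i => (R i).comp ((X - C α) ^ 2)
  have hPmon : ∀ i, (P i).Monic := fun i =>
    (hmon i).1.comp ((monic_X_sub_C α).pow 2) (by rw [hdeg]; exact two_ne_zero)
  let ε : Fin n → Module.AEval' y := fun i => e.symm (Pi.single i (Ideal.Quotient.mk _ 1))
  have hε : ∀ i, R i • ε i = 0 := fun i => by
    rw [← map_smul, ← Pi.single_smul]
    have : R i • Ideal.Quotient.mk (Ideal.span {R i}) 1 = 0 := by
      change Ideal.Quotient.mk (Ideal.span {R i}) (R i * 1) = 0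
      rw [mul_one, Ideal.Quotient.eq_zero_iff_mem]
      exact Ideal.mem_span_singleton_self _
    rw [this, Pi.single_zero, map_zero]
  let x : Fin n → Fp := fun i => (Module.AEval'.of y).symm (ε i)
  have hx : ∀ i, aeval w (P i) (x i : F) = 0 := fun i => by
    rw [hcomp, ← hy]
    have : aeval y (R i) (x i) = 0 := congrArg (Module.AEval'.of y).symm (hε i)
    rw [this]; rfl
  let Φ : ((i : Fin n) → K[X] ⧸ Ideal.span {P i}) →ₗ[K[X]] Module.AEval' w :=
    ∑ i, (Submodule.liftQ (Ideal.span {P i})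
      (LinearMap.toSpanSingleton K[X] _ (Module.AEval'.of w (x i))) (by
        rw [Ideal.span, Submodule.span_singleton_le_iff_mem, LinearMap.mem_ker,
          LinearMap.toSpanSingleton_apply, ← Module.AEval.of_aeval_smul,
          LinearEquiv.map_eq_zero_iff]
        exact hx i)).comp (LinearMap.proj i)
  have hΦ : ∀ f : Fin n → K[X], Φ (fun i => Ideal.Quotient.mk _ (f i)) =
      ∑ i, f i • Module.AEval'.of w (x i : F) := fun f => by
    simp only [Φ, LinearMap.sum_apply]
    exact Finset.sum_congr rfl fun i _ => rfl
  have hpos : ∀ t ∈ Fp, Module.AEval'.of w t ∈ LinearMap.range Φ := fun t ht => by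
    choose f hf using fun i => Ideal.Quotient.mk_surjective (e (Module.AEval'.of y ⟨t, ht⟩) i)
    have h1 : Module.AEval'.of y ⟨t, ht⟩ = ∑ i, f i • ε i := by
      apply e.injective
      rw [map_sum]
      simp only [map_smul, ε, LinearEquiv.apply_symm_apply]
      funext j
      rw [Finset.sum_apply, Finset.sum_eq_single j]
      · rw [Pi.smul_apply, Pi.single_eq_same, ← hf j]
        change _ = Ideal.Quotient.mk _ (f j * 1)
        rw [mul_one]
      · intro i _ hij
        rw [Pi.smul_apply, Pi.single_eq_of_ne hij.symm, smul_zero]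
      · simp
    have h2 : t = ∑ i, aeval (z ^ 2) (f i) (x i : F) := by
      have h3 := congrArg (fun m => (((Module.AEval'.of y).symm m : Fp) : F)) h1
      simp only [map_sum, LinearEquiv.symm_apply_apply] at h3
      rw [h3, Submodule.coe_sum]
      exact Finset.sum_congr rfl fun i _ => hy (f i) (x i)
    refine ⟨fun i => Ideal.Quotient.mk _ ((f i).comp ((X - C α) ^ 2)), ?_⟩
    rw [hΦ, h2, map_sum]
    refine Finset.sum_congr rfl fun i _ => ?_
    rw [← Module.AEval.of_aeval_smul, hcomp]
    rfl
  have hzX : ∀ t, Module.AEval'.of w (z t) = (X - C α : K[X]) • Module.AEval'.of w t := fun t => by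
    rw [← Module.AEval.of_aeval_smul, hz]
    simp [Module.algebraMap_end_apply]
  -- By finite dimension `t = z s`, and anticommutation with injectivity of `z` forces `s` to be
  -- fixed by `σ`.
  have hneg : ∀ t, σ t = -t → Module.AEval'.of w t ∈ LinearMap.range Φ := fun t ht => by
    obtain ⟨s, rfl⟩ := LinearMap.injective_iff_surjective.1 hinj t
    rw [hσz, neg_inj] at ht
    rw [hzX]
    exact Submodule.smul_mem _ _ (hpos s ((hFp s).2 (hinj ht)))
  have hsurj : Function.Surjective Φ := fun m => by
    obtain ⟨t, rfl⟩ := (Module.AEval'.of w).surjective m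
    have ht : t = (2 : K)⁻¹ • (t + σ t) + (2 : K)⁻¹ • (t - σ t) := by
      rw [← smul_add, add_add_sub_cancel, ← two_smul K t, inv_smul_smul₀ h2]
    rw [ht, map_add]
    refine Submodule.add_mem (LinearMap.range Φ) (hpos _ ?_) (hneg _ ?_)
    · rw [hFp, map_smul, map_add, hσ, add_comm]
    · rw [map_smul, map_sub, hσ, ← smul_neg, neg_sub]
  have hfin : ∀ i, Module.Finite K (K[X] ⧸ Ideal.span {P i}) := fun i => (hPmon i).finite_quotient
  -- The source has dimension `2 ∑ deg R i = 2 dim Fp`, and `Fp` and `z Fp` are independent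
  -- subspaces of the same dimension. The surjection `Φ` is therefore bijective.
  have hrank : Module.finrank K ((i : Fin n) → K[X] ⧸ Ideal.span {P i}) ≤ Module.finrank K F := by
    have h3 : Module.finrank K Fp = ∑ i, (R i).natDegree := by
      rw [← finrank_pi_quotient fun i => (hmon i).1.ne_zero,
        (Module.AEval'.of y).finrank_eq, (e.restrictScalars K).finrank_eq]
    have h4 : Module.finrank K (Fp.map z) = Module.finrank K Fp :=
  (Submodule.equivMapOfInjective z hinj Fp).finrank_eq.symm
    have h5 : Disjoint Fp (Fp.map z) := by
      rw [Submodule.disjoint_def]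
      rintro _ hx ⟨s, hs, rfl⟩
      rw [hFp, hσz, (hFp s).1 hs, neg_eq_iff_add_eq_zero, ← two_smul K] at hx
      exact (smul_eq_zero.1 hx).resolve_left h2
    have h6 := Submodule.finrank_add_finrank_le_of_disjoint h5
    rw [finrank_pi_quotient fun i => (hPmon i).ne_zero]
    simp only [P, natDegree_comp, hdeg]
    rw [← Finset.sum_mul]
    omega
  have hrank' : Module.finrank K ((i : Fin n) → K[X] ⧸ Ideal.span {P i}) =
      Module.finrank K (Module.AEval' w) := by
    refine le_antisymm (hrank.trans_eq (Module.AEval'.of w).finrank_eq) ?_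
    exact LinearMap.finrank_le_finrank_of_surjective (f := Φ.restrictScalars K) hsurj
  have hΦinj : Function.Injective Φ :=
    (LinearMap.injective_iff_surjective_of_finrank_eq_finrank (f := Φ.restrictScalars K)
      hrank').2 hsurj
  refine ⟨n, P, ⟨fun i => ⟨hPmon i, ?_⟩, fun i j hij => ?_,
    ⟨(LinearEquiv.ofBijective Φ ⟨hΦinj, hsurj⟩).symm⟩⟩, fun i => ⟨R i, rfl⟩⟩
  · simp only [P, natDegree_comp, hdeg]
    have := (hmon i).2
    omega
  · exact map_dvd (compRingHom ((X - C α) ^ 2)) (hdvd i j hij)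

end EvenInvariantFactors

/-! ### Necessity of the condition on elementary factors -/

section Necessity

variable {K E : Type*} [Field K] [AddCommGroup E] [Module K E]

/-- Describing `Ker Q(u)` as the image of a power of `T(u)` makes its stability under `D` visible
without knowing how `Q` behaves under `X ↦ 2α - X`. -/
theorem mem_awaySubspace_iff {S : Set K} {u : Module.End K E} {T : K[X]}
    (hT : ∀ a ∈ S, X - C a ∣ T) (hT' : IsCoprime T (rootFreePart S (minpoly K u))) (x : E) :
    x ∈ awaySubspace S u ↔
      x ∈ LinearMap.range (aeval u T ^ (minpoly K u).roots.card) := by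
  set m := (minpoly K u).roots.card
  set Q := rootFreePart S (minpoly K u) with hQ
  constructor
  · intro hx
    have hx' : aeval u Q x = 0 := hx
    obtain ⟨a, b, hab⟩ := hT'.pow_left (m := m)
    refine ⟨aeval u a x, ?_⟩
    have h := congrArg (fun f => aeval u f x) hab
    simp only [map_add, map_mul, LinearMap.add_apply, Module.End.mul_apply, hx', map_zero,
      add_zero, map_one, Module.End.one_apply] at h
    rw [← map_pow, ← Module.End.mul_apply, ← map_mul, mul_comm, map_mul, Module.End.mul_apply, h]
  · rintro ⟨y, rfl⟩
    obtain ⟨g, hg⟩ := rootsPart_dvd_pow (p := minpoly K u) hT (le_refl m)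
    change aeval u Q _ = 0
    rw [← map_pow, ← Module.End.mul_apply, ← map_mul, hg,
      show Q * (rootsPart S (minpoly K u) * g) = g * (rootsPart S (minpoly K u) * Q) by ring,
      rootsPart_mul_rootFreePart, map_mul, minpoly.aeval, mul_zero, LinearMap.zero_apply]

theorem IsComposite.exists_elementaryFactors_awayPart [FiniteDimensional K E] (hK : ringChar K ≠ 2)
    {α : K} {u : Module.End K E} (h : IsComposite α α u) :
    ∃ (N : ℕ) (P : Fin N → K[X]),
      IsElementaryFactors (awayPart {0, α, 2 * α} u) P ∧
      ∀ i, ∃ Q : K[X], P i = Q.comp ((X - C α) ^ 2) := by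
  have h2 : (2 : K) ≠ 0 := Ring.two_ne_zero hK
  have hμ : minpoly K u ≠ 0 := minpoly.ne_zero (Algebra.IsIntegral.isIntegral u)
  obtain ⟨D, hv, hD⟩ := h.exists_anticommuting
  have hu : ∀ x, D (u x) = (2 * α) • D x - u (D x) := fun x => by
    have := hv x
    rw [map_sub, map_smul, sub_eq_iff_eq_add] at this
    rw [this]
    module
  set S : Set K := {0, α, 2 * α} with hS
  have h0S : (0 : K) ∈ S := by simp [hS]
  have hαS : α ∈ S := by simp [hS]
  have h2S : 2 * α ∈ S := by simp [hS]
  have hcop : ∀ a ∈ S, IsCoprime (X - C a) (rootFreePart S (minpoly K u)) := fun a ha =>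
    isCoprime_X_sub_C_of_not_isRoot (not_isRoot_rootFreePart hμ ha)
  let W := awaySubspace S u
  let w : Module.End K W := awayPart S u
  have hw : ∀ x : W, (w x : E) = u x := fun x => rfl
  have hinj : ∀ a ∈ S, Function.Injective (w - algebraMap K (Module.End K W) a) := by
    intro a ha
    rw [← LinearMap.ker_eq_bot, LinearMap.ker_eq_bot']
    intro x hx
    obtain ⟨f, g, hfg⟩ := hcop a ha
    have hQ : aeval u (rootFreePart S (minpoly K u)) (x : E) = 0 := x.2
    have hXa : aeval u (X - C a) (x : E) = 0 := by
      have := congrArg Subtype.val hx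
      simpa [Module.algebraMap_end_apply, hw] using this
    have h := congrArg (fun f => aeval u f (x : E)) hfg
    simp only [map_add, map_mul, LinearMap.add_apply, Module.End.mul_apply, hQ, hXa, map_zero,
      add_zero, map_one, Module.End.one_apply] at h
    exact Subtype.ext h.symm
  have hbij : Function.Bijective w := by
    have h0 := hinj 0 h0S
    rw [map_zero, sub_zero] at h0
    exact ⟨h0, LinearMap.injective_iff_surjective.1 h0⟩
  -- This product is odd under `X ↦ 2α - X`, so `D` anticommutes with `T(u)` and preserves the
  -- images of its powers.
  let T : K[X] := (X - C 0) * (X - C (2 * α)) * (X - C α)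
  have hTS : ∀ a ∈ S, X - C a ∣ T := by
    rintro a (rfl | rfl | rfl)
    · exact (dvd_mul_right _ _).mul_right _
    · exact dvd_mul_left _ _
    · exact (dvd_mul_left _ _).mul_right _
  have hTcop : IsCoprime T (rootFreePart S (minpoly K u)) :=
    ((hcop 0 h0S).mul_left (hcop _ h2S)).mul_left (hcop α hαS)
  have hDT : ∀ x, D (aeval u T x) = -aeval u T (D x) := fun x => by
    simp only [T, map_mul, map_sub, aeval_X, aeval_C, Module.End.mul_apply, LinearMap.sub_apply,
      Module.algebraMap_end_apply, map_smul, hu]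
    module
  have hDpow : ∀ k x, D ((aeval u T ^ k) x) ∈ LinearMap.range (aeval u T ^ k) := by
    intro k
    induction k with
    | zero => intro x; simp
    | succ k ih =>
      intro x
      obtain ⟨t, ht⟩ := ih x
      refine ⟨-t, ?_⟩
      rw [pow_succ', Module.End.mul_apply, Module.End.mul_apply, hDT, ← ht, map_neg, map_neg]
  have hDW : ∀ x ∈ W, D x ∈ W := by
    intro x hx
    obtain ⟨t, rfl⟩ := (mem_awaySubspace_iff hTS hTcop x).1 hx
    exact (mem_awaySubspace_iff hTS hTcop _).2 (hDpow _ t)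
  let d : Module.End K W := D.restrict hDW
  have hdu : ∀ x, d (w x) = (2 * α) • d x - w (d x) := fun x => Subtype.ext (hu x)
  have hdd : ∀ x, d (d x) = (2 * α) • w x - w (w x) := fun x => Subtype.ext (hD x)
  let ω := LinearEquiv.ofBijective w hbij
  -- From `d w = (2α - w) d` and `d² = w (2α - w)`, the square of `w⁻¹ d` is the identity, once `2α
  -- - w` is cancelled.
  let σ : Module.End K W := ω.symm.toLinearMap.comp d
  have hσ : ∀ x, w (σ x) = d x := fun x => ω.apply_symm_apply (d x)
  let z : Module.End K W := w - algebraMap K (Module.End K W) α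
  have hz : ∀ x, z x = w x - α • x := fun x => by simp [z, Module.algebraMap_end_apply]
  refine exists_even_elementaryFactors h2 (σ := σ) hz (fun x => hbij.1 ?_) (fun x => hbij.1 ?_)
    (hinj α hαS)
  · rw [hσ]
    apply hinj _ h2S
    have h3 := hdu (σ x)
    rw [hσ, hdd] at h3
    simp only [LinearMap.sub_apply, Module.algebraMap_end_apply]
    rw [← neg_inj, neg_sub, neg_sub, ← h3]
  · rw [hσ, map_neg, hz, hz, map_sub, map_sub, map_smul, map_smul, hdu, hσ]
    module

end Necessity

/-- Invariant factors exist and are unique, so the existential form of (ii) agrees with a condition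
on every elementary factor. -/
theorem theorem4 {K E : Type*} [Field K] [AddCommGroup E] [Module K E] [FiniteDimensional K E]
    (hK : ringChar K ≠ 2) (α : K) (hα : α ≠ 0) (u : Module.End K E) :
    IsComposite α α u ↔
      Intertwined (jordanCount u 0) (jordanCount u (2 * α)) ∧
      ∃ (N : ℕ) (P : Fin N → K[X]),
        IsElementaryFactors (awayPart {0, α, 2 * α} u) P ∧
        ∀ i, ∃ Q : K[X], P i = Q.comp ((X - C α) ^ 2) := by
  constructor
  · intro h
    exact ⟨h.intertwined hK hα, h.exists_elementaryFactors_awayPart hK⟩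
  · rintro ⟨hI, N, P, hP, hPQ⟩
    exact (hasReflection_of_intertwined hK hα hI hP hPQ).isComposite hK hα
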